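/- Let $m,n$ be nonnegative integers. Write $(a)_k=a(a+1)\cdots(a+k-1)$ (with $(a)_0=1$) for the Pochhammer symbol, and for a nonnegative integer $N$ and $c\ne 0,-1,\dots,-N+1$ put ${}_2F_1(-N,b;c;z)=\sum_{k=0}^{N}\frac{(-N)_k(b)_k}{(c)_k\,k!}z^k$. All powers with non-integer exponent are principal values. (i) Let $\alpha>0$. The Gauss series ${}_2F_1(m+1,-\alpha;n+m+2;w)=\sum_{k\ge0}\frac{(m+1)_k(-\alpha)_k}{(n+m+2)_k\,k!}w^k$ $(|w|<1)$ has a unique analytic continuation to $w\in\mathbb{C}\setminus[1,\infty)$, denoted by the same symbol, and for all $z\in\mathbb{C}\setminus[0,1]$ $$(1-z)^{-n-1}(1-z^{-1})^{-\alpha}\,{}_2F_1(m+1,-\alpha;n+m+2;z^{-1})$$ $$=\frac{(n+1)_{m+1}}{(n+\alpha+1)_{m+1}}\,z^{m+1}(1-z)^{-n-1}(1-z^{-1})^{-\alpha}\,{}_2F_1(-n,m+1;-n-\alpha;1-z)+\frac{(m+1)_{n+1}}{(m+\alpha+1)_{n+1}}\,{}_2F_1(-m,n+1;-m-\alpha;z).$$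 Moreover, each of the three terms (the left-hand side and the two summands on the right) is a holomorphic solution on $\mathbb{C}\setminus[0,1]$ of $$z(1-z)u''(z)-\bigl((n+2)z+m(1-z)+\alpha\bigr)u'(z)+m(n+1)u(z)=0,$$ which is the hypergeometric equation $z(1-z)u''+(c-(a+b+1)z)u'-abu=0$ with $(a,b,c)=(-m,n+1,-m-\alpha)$. (ii) For every $z\in\mathbb{C}\setminus[0,1]$, as $\alpha\downarrow0$ the left-hand side tends to $(1-z)^{-n-1}$, the first summand on the right tends to $z^{m+1}\sum_{k=0}^n\frac{(m+1)_k}{k!}(1-z)^{k-n-1}$, and the second summand tends to $\sum_{k=0}^m\frac{(n+1)_k}{k!}z^k$. Thus the identity tends to $$(1-x)^{-n-1}=\sum_{k=0}^m\frac{(n+1)_k}{k!}x^k+x^{m+1}\sum_{k=0}^n\frac{(m+1)_k}{k!}(1-x)^{k-n-1},$$ which holds for all $x\in\mathbb{C}\setminus\{1\}$, and whose three terms solve the differential equation above with $\alpha=0$ on $\mathbb{C}\setminus[0,1]$. -/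

import Mathlib

open Set Filter Topology

namespace ChaundyBullard

noncomputable section

/-- The Pochhammer symbol `(a)_k = a (a+1) ⋯ (a+k-1)`. -/
def poch (a : ℂ) (k : ℕ) : ℂ := (ascPochhammer ℂ k).eval a

/-- The plane `ℂ ∖ [1,∞)`. -/
def slit : Set ℂ := (Complex.ofReal '' Ici (1 : ℝ))ᶜ

/-- The plane `ℂ ∖ [0,1]`. -/
def cutPlane : Set ℂ := (Complex.ofReal '' Icc (0 : ℝ) 1)ᶜ

/-- `F` is a holomorphic function on `ℂ ∖ [1,∞)` which on the unit disc is the sum of the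
Gauss hypergeometric series with parameters `a, b; c`. -/
def IsContinuation (a b c : ℂ) (F : ℂ → ℂ) : Prop :=
  DifferentiableOn ℂ F slit ∧ ∀ w : ℂ, ‖w‖ < 1 → F w = ordinaryHypergeometric a b c w

/-- The Gauss hypergeometric function `₂F₁(a,b;c;·)` on `ℂ ∖ [1,∞)`: the analytic continuation
of the hypergeometric series (a meaningless function if there is no continuation). -/
def hyp (a b c : ℂ) : ℂ → ℂ := Classical.epsilon (IsContinuation a b c)

/-- The terminating series `₂F₁(-N,b;c;z)`, a polynomial in `z`, for `c ≠ 0,-1,…,-N+1`. -/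
def hypTerm (N : ℕ) (b c z : ℂ) : ℂ :=
  ∑ k ∈ Finset.range (N + 1), poch (-(N : ℂ)) k * poch b k / (poch c k * (k.factorial : ℂ)) * z ^ k

/-- The function `(1-z)^{-n-1} (1-z⁻¹)^{-α} ₂F₁(m+1,-α;n+m+2;z⁻¹)`, with the principal branch of
the power of `1-z⁻¹`. -/
def leftTerm (m n : ℕ) (α : ℝ) (z : ℂ) : ℂ :=
  (1 - z) ^ (-(n : ℤ) - 1) * (1 - z⁻¹) ^ (-(α : ℂ)) *
    hyp ((m : ℂ) + 1) (-(α : ℂ)) ((n : ℂ) + m + 2) z⁻¹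

/-- The function
`(n+1)_{m+1} / (n+α+1)_{m+1} · z^{m+1} (1-z)^{-n-1} (1-z⁻¹)^{-α} ₂F₁(-n,m+1;-n-α;1-z)`. -/
def rightTerm₁ (m n : ℕ) (α : ℝ) (z : ℂ) : ℂ :=
  poch ((n : ℂ) + 1) (m + 1) / poch ((n : ℂ) + α + 1) (m + 1) *
    z ^ (m + 1) * (1 - z) ^ (-(n : ℤ) - 1) * (1 - z⁻¹) ^ (-(α : ℂ)) *
    hypTerm n ((m : ℂ) + 1) (-(n : ℂ) - α) (1 - z)

/-- The function `(m+1)_{n+1} / (m+α+1)_{n+1} · ₂F₁(-m,n+1;-m-α;z)`. -/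
def rightTerm₂ (m n : ℕ) (α : ℝ) (z : ℂ) : ℂ :=
  poch ((m : ℂ) + 1) (n + 1) / poch ((m : ℂ) + α + 1) (n + 1) *
    hypTerm m ((n : ℂ) + 1) (-(m : ℂ) - α) z

/-- The function `(1-x)^{-n-1}`. -/
def leftTerm₀ (n : ℕ) (x : ℂ) : ℂ := (1 - x) ^ (-(n : ℤ) - 1)

/-- The function `x^{m+1} ∑_{k=0}^n (m+1)_k / k! · (1-x)^{k-n-1}`. -/
def rightTerm₁₀ (m n : ℕ) (x : ℂ) : ℂ :=
  x ^ (m + 1) * ∑ k ∈ Finset.range (n + 1),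
    poch ((m : ℂ) + 1) k / (k.factorial : ℂ) * (1 - x) ^ ((k : ℤ) - n - 1)

/-- The function `∑_{k=0}^m (n+1)_k / k! · x^k`. -/
def rightTerm₂₀ (m n : ℕ) (x : ℂ) : ℂ :=
  ∑ k ∈ Finset.range (m + 1), poch ((n : ℂ) + 1) k / (k.factorial : ℂ) * x ^ k

/-- `u` is holomorphic on the open set `U` and there solves
`z(1-z)u'' - ((n+2)z + m(1-z) + α)u' + m(n+1)u = 0`, the hypergeometric differential equation
`z(1-z)u'' + (c-(a+b+1)z)u' - abu = 0` for `(a,b,c) = (-m,n+1,-m-α)`. -/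
def SolvesODE (m n : ℕ) (α : ℝ) (U : Set ℂ) (u : ℂ → ℂ) : Prop :=
  DifferentiableOn ℂ u U ∧ ∀ z ∈ U,
    z * (1 - z) * deriv (deriv u) z
      - (((n : ℂ) + 2) * z + m * (1 - z) + α) * deriv u z + m * ((n : ℂ) + 1) * u z = 0

end

end ChaundyBullard

open ChaundyBullard

/-!
The function `wᵐ⁺ⁿ⁺¹ ₂F₁(m+1, -α; m+n+2; w)` is, up to a constant, the `(n+1)`-fold primitive
vanishing at `0` of `wᵐ ₂F₁(m+1, -α; m+1; w) = wᵐ (1 - w)^α`. Such primitives can be written down in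
terms of Lagrange polynomials, the coefficients of `tᵏ` in `(1 - xt)⁻ᵃ (1 - yt)⁻ᵇ`: their contiguous
relations give the derivatives of a sum of two terms, one polynomial and one with the factor
`(1 - w)^α`. Lagrange polynomials are homogeneous forms of terminating hypergeometric series, so at
`w = z⁻¹` these two terms become the right-hand side of the identity. All three terms are continuous
in `α` at `0`, which gives the limits, and the limit identity extends from `ℂ ∖ [0,1]` to `x ≠ 1` by
analytic continuation.
-/

namespace ChaundyBullard

section LagrangePolynomials

variable {R : Type*} [CommRing R] [BinomialRing R]

open Ring (multichoose)

lemma succ_mul_multichoose_succ (r : R) (k : ℕ) :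
    (k + 1 : R) * multichoose r (k + 1) = (r + k) * multichoose r k := by
  have := BinomialRing.toIsAddTorsionFree (R := R)
  refine nsmul_right_injective k.factorial_ne_zero ?_
  have h := Ring.factorial_nsmul_multichoose_eq_ascPochhammer r (k + 1)
  rw [ascPochhammer_succ_right, Polynomial.smeval_mul, Polynomial.smeval_add,
    Polynomial.smeval_X, Polynomial.smeval_natCast, pow_zero, pow_one, nsmul_one,
    ← Ring.factorial_nsmul_multichoose_eq_ascPochhammer, Nat.factorial_succ] at h
  simp only [nsmul_eq_mul] at h ⊢
  push_cast at h
  linear_combination h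

lemma mul_multichoose_add_one (r : R) (k : ℕ) :
    r * multichoose (r + 1) k = (r + k) * multichoose r k := by
  induction k with
  | zero => simp
  | succ k ih =>
    rw [Ring.multichoose_succ_succ, mul_add, ih, ← succ_mul_multichoose_succ]
    push_cast
    ring

/-- The two-variable Lagrange polynomial `∑ (a)ᵢ (b)ⱼ / (i! j!) xⁱ yʲ` over `i + j = n`, that is the
coefficient of `tⁿ` in `(1 - x t)⁻ᵃ (1 - y t)⁻ᵇ`. It is the common homogeneous form of the two
terminating series of the three-term identity. -/
def lagrangePoly (a b : R) (n : ℕ) (x y : R) : R :=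
  ∑ p ∈ Finset.HasAntidiagonal.antidiagonal n,
    multichoose a p.1 * multichoose b p.2 * x ^ p.1 * y ^ p.2

lemma lagrangePoly_zero (a b x y : R) : lagrangePoly a b 0 x y = 1 := by
  simp [lagrangePoly]

lemma lagrangePoly_swap (a b : R) (n : ℕ) (x y : R) :
    lagrangePoly a b n x y = lagrangePoly b a n y x := by
  rw [lagrangePoly, lagrangePoly, ← Finset.Nat.sum_antidiagonal_swap]
  exact Finset.sum_congr rfl fun p _ => by simp only [Prod.fst_swap, Prod.snd_swap]; ring

lemma lagrangePoly_smul (a b : R) (n : ℕ) (c x y : R) :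
    lagrangePoly a b n (c * x) (c * y) = c ^ n * lagrangePoly a b n x y := by
  rw [lagrangePoly, lagrangePoly, Finset.mul_sum]
  refine Finset.sum_congr rfl fun p hp => ?_
  rw [← Finset.HasAntidiagonal.mem_antidiagonal.mp hp, mul_pow, mul_pow, pow_add]
  ring

lemma lagrangePoly_apply_zero_left (a b : R) (n : ℕ) (y : R) :
    lagrangePoly a b n 0 y = multichoose b n * y ^ n := by
  cases n <;> simp [lagrangePoly, Finset.Nat.sum_antidiagonal_succ]

lemma lagrangePoly_zero_left (b : R) (n : ℕ) (x y : R) :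
    lagrangePoly 0 b n x y = multichoose b n * y ^ n := by
  cases n <;> simp [lagrangePoly, Finset.Nat.sum_antidiagonal_succ, Ring.multichoose_zero_succ]

lemma lagrangePoly_one_right_apply_one (a : R) (n : ℕ) (x : R) :
    lagrangePoly a 1 n x 1 = ∑ k ∈ Finset.range (n + 1), multichoose a k * x ^ k := by
  simp [lagrangePoly, Finset.Nat.sum_antidiagonal_eq_sum_range_succ_mk, Ring.multichoose_one]

lemma lagrangePoly_add_one_left (a b : R) (n : ℕ) (x y : R) :
    lagrangePoly (a + 1) b (n + 1) x y =
      lagrangePoly a b (n + 1) x y + x * lagrangePoly (a + 1) b n x y := by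
  simp only [lagrangePoly, Finset.Nat.sum_antidiagonal_succ, Ring.multichoose_succ_succ,
    Ring.multichoose_zero_right, add_mul, Finset.sum_add_distrib, Finset.mul_sum, add_assoc]
  congr 2
  exact Finset.sum_congr rfl fun p _ => by ring

lemma lagrangePoly_add_one_right (a b : R) (n : ℕ) (x y : R) :
    lagrangePoly a (b + 1) (n + 1) x y =
      lagrangePoly a b (n + 1) x y + y * lagrangePoly a (b + 1) n x y := by
  simpa only [lagrangePoly_swap a] using lagrangePoly_add_one_left b a n y x

lemma mul_lagrangePoly_add_one (a b : R) (n : ℕ) (x y : R) :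
    a * lagrangePoly (a + 1) b n x y + b * lagrangePoly a (b + 1) n x y =
      (a + b + n) * lagrangePoly a b n x y := by
  simp only [lagrangePoly, Finset.mul_sum, ← Finset.sum_add_distrib]
  refine Finset.sum_congr rfl fun p hp => ?_
  rw [← Finset.HasAntidiagonal.mem_antidiagonal.mp hp]
  push_cast
  linear_combination multichoose b p.2 * x ^ p.1 * y ^ p.2 * mul_multichoose_add_one a p.1 +
    multichoose a p.1 * x ^ p.1 * y ^ p.2 * mul_multichoose_add_one b p.2

lemma succ_mul_lagrangePoly_succ (a b : R) (n : ℕ) (x y : R) :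
    (n + 1 : R) * lagrangePoly a b (n + 1) x y =
      a * x * lagrangePoly (a + 1) b n x y + b * y * lagrangePoly a (b + 1) n x y := by
  have h := mul_lagrangePoly_add_one a b (n + 1) x y
  push_cast at h
  linear_combination a * lagrangePoly_add_one_left a b n x y +
    b * lagrangePoly_add_one_right a b n x y - h

lemma lagrangePoly_add_one_right_sub_left (a b : R) (n : ℕ) (x y : R) :
    lagrangePoly a (b + 1) (n + 1) x y - lagrangePoly (a + 1) b (n + 1) x y =
      (y - x) * lagrangePoly (a + 1) (b + 1) n x y := by
  cases n with
  | zero =>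
    have h₁ := lagrangePoly_add_one_left a b 0 x y
    have h₂ := lagrangePoly_add_one_right a b 0 x y
    simp only [lagrangePoly_zero] at *
    linear_combination h₂ - h₁
  | succ n =>
    linear_combination lagrangePoly_add_one_right a b (n + 1) x y -
      lagrangePoly_add_one_left a b (n + 1) x y -
      y * lagrangePoly_add_one_left a (b + 1) n x y +
      x * lagrangePoly_add_one_right (a + 1) b n x y

end LagrangePolynomials

section Derivative

variable {𝕜 : Type*} [NontriviallyNormedField 𝕜] [BinomialRing 𝕜]

lemma hasDerivAt_lagrangePoly {a b : 𝕜} {n : ℕ} {f g : 𝕜 → 𝕜} {f' g' t : 𝕜}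
    (hf : HasDerivAt f f' t) (hg : HasDerivAt g g' t) :
    HasDerivAt (fun t => lagrangePoly a b (n + 1) (f t) (g t))
      (a * lagrangePoly (a + 1) b n (f t) (g t) * f' +
        b * lagrangePoly a (b + 1) n (f t) (g t) * g') t := by
  have h : HasDerivAt (fun t => lagrangePoly a b (n + 1) (f t) (g t))
      (∑ p ∈ Finset.HasAntidiagonal.antidiagonal (n + 1),
        Ring.multichoose a p.1 * Ring.multichoose b p.2 *
          (p.1 * f t ^ (p.1 - 1) * f' * g t ^ p.2 +
            f t ^ p.1 * (p.2 * g t ^ (p.2 - 1) * g'))) t := by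
    simp only [lagrangePoly, mul_assoc _ (f _ ^ _) (g _ ^ _)]
    exact HasDerivAt.fun_sum fun p _ => ((hf.fun_pow p.1).fun_mul (hg.fun_pow p.2)).const_mul _
  convert h using 1
  simp only [mul_add, Finset.sum_add_distrib]
  congr 1
  · rw [Finset.Nat.sum_antidiagonal_succ]
    simp only [lagrangePoly, Finset.mul_sum, Finset.sum_mul]
    simp only [Nat.cast_zero, Nat.add_sub_cancel, Nat.cast_succ, zero_mul, mul_zero, zero_add]
    refine Finset.sum_congr rfl fun p _ => ?_
    linear_combination Ring.multichoose b p.2 * f t ^ p.1 * f' * g t ^ p.2 *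
      (mul_multichoose_add_one a p.1 - succ_mul_multichoose_succ a p.1)
  · rw [Finset.Nat.sum_antidiagonal_succ']
    simp only [lagrangePoly, Finset.mul_sum, Finset.sum_mul]
    simp only [Nat.cast_zero, Nat.add_sub_cancel, Nat.cast_succ, zero_mul, mul_zero, zero_add]
    refine Finset.sum_congr rfl fun p _ => ?_
    linear_combination Ring.multichoose a p.1 * f t ^ p.1 * g' * g t ^ p.2 *
      (mul_multichoose_add_one b p.2 - succ_mul_multichoose_succ b p.2)

end Derivative

section HypergeometricEquation

/-- `u` is holomorphic on `U` and there solves the hypergeometric differential equation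
`z(1-z)u'' + (c-(a+b+1)z)u' - abu = 0`. The derivatives are meaningful for open `U` only. -/
def IsHypergeometricSolution (a b c : ℂ) (U : Set ℂ) (u : ℂ → ℂ) : Prop :=
  DifferentiableOn ℂ u U ∧ ∀ z ∈ U,
    z * (1 - z) * deriv (deriv u) z + (c - (a + b + 1) * z) * deriv u z - a * b * u z = 0

variable {a b c : ℂ} {U : Set ℂ} {u v : ℂ → ℂ}

lemma solvesODE_iff {m n : ℕ} {α : ℝ} :
    SolvesODE m n α U u ↔ IsHypergeometricSolution (-m) (n + 1) (-m - α) U u := by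
  refine and_congr_right fun _ => forall₂_congr fun z _ => ?_
  rw [show (-(m : ℂ) - α - (-m + (n + 1) + 1) * z) = -((n + 2) * z + m * (1 - z) + α) by ring]
  ring_nf

lemma isHypergeometricSolution_of_hasDerivAt (hU : IsOpen U) {u₁ u₂ : ℂ → ℂ}
    (h₁ : ∀ z ∈ U, HasDerivAt u (u₁ z) z) (h₂ : ∀ z ∈ U, HasDerivAt u₁ (u₂ z) z)
    (h : ∀ z ∈ U, z * (1 - z) * u₂ z + (c - (a + b + 1) * z) * u₁ z - a * b * u z = 0) :
    IsHypergeometricSolution a b c U u := by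
  refine ⟨fun z hz => (h₁ z hz).differentiableAt.differentiableWithinAt, fun z hz => ?_⟩
  have hu' : deriv u =ᶠ[𝓝 z] u₁ := by
    filter_upwards [hU.mem_nhds hz] with w hw using (h₁ w hw).deriv
  rw [hu'.deriv_eq, (h₂ z hz).deriv, (h₁ z hz).deriv, h z hz]

namespace IsHypergeometricSolution

lemma hasDerivAt (hu : IsHypergeometricSolution a b c U u) (hU : IsOpen U) {z : ℂ} (hz : z ∈ U) :
    HasDerivAt u (deriv u z) z :=
  (hu.1.differentiableAt (hU.mem_nhds hz)).hasDerivAt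

lemma hasDerivAt_deriv (hu : IsHypergeometricSolution a b c U u) (hU : IsOpen U) {z : ℂ}
    (hz : z ∈ U) : HasDerivAt (deriv u) (deriv (deriv u) z) z :=
  ((hu.1.deriv hU).differentiableAt (hU.mem_nhds hz)).hasDerivAt

lemma mono {V : Set ℂ} (hu : IsHypergeometricSolution a b c U u) (hV : V ⊆ U) :
    IsHypergeometricSolution a b c V u :=
  ⟨hu.1.mono hV, fun z hz => hu.2 z (hV hz)⟩

lemma congr (hu : IsHypergeometricSolution a b c U u) (hU : IsOpen U) (h : EqOn v u U) :
    IsHypergeometricSolution a b c U v := by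
  refine ⟨hu.1.congr h, fun z hz => ?_⟩
  have hvu : v =ᶠ[𝓝 z] u := h.eventuallyEq_of_mem (hU.mem_nhds hz)
  rw [hvu.deriv.deriv_eq, hvu.deriv_eq, h hz, hu.2 z hz]

lemma add (hu : IsHypergeometricSolution a b c U u) (hv : IsHypergeometricSolution a b c U v)
    (hU : IsOpen U) : IsHypergeometricSolution a b c U (fun z => u z + v z) :=
  isHypergeometricSolution_of_hasDerivAt hU
    (fun _ hz => (hu.hasDerivAt hU hz).add (hv.hasDerivAt hU hz))
    (fun _ hz => (hu.hasDerivAt_deriv hU hz).add (hv.hasDerivAt_deriv hU hz))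
    fun z hz => by linear_combination hu.2 z hz + hv.2 z hz

lemma const_mul (hu : IsHypergeometricSolution a b c U u) (hU : IsOpen U) (k : ℂ) :
    IsHypergeometricSolution a b c U (fun z => k * u z) :=
  isHypergeometricSolution_of_hasDerivAt hU
    (fun _ hz => (hu.hasDerivAt hU hz).const_mul k)
    (fun _ hz => (hu.hasDerivAt_deriv hU hz).const_mul k)
    fun z hz => by linear_combination k * hu.2 z hz

lemma comp_one_sub (hu : IsHypergeometricSolution a b c U u) (hU : IsOpen U) :
    IsHypergeometricSolution a b (a + b + 1 - c) ((1 - ·) ⁻¹' U) (fun z => u (1 - z)) := by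
  refine isHypergeometricSolution_of_hasDerivAt (hU.preimage (by fun_prop))
    (fun z hz => (hu.hasDerivAt hU hz).comp_const_sub 1 z)
    (fun z hz => ((hu.hasDerivAt_deriv hU hz).comp_const_sub 1 z).neg) fun z hz => ?_
  linear_combination hu.2 (1 - z) hz

/-- The prefactor `p` stands for any branch of `z ^ (1 - c) * (1 - z) ^ (c - a - b)`. -/
lemma mul_of_logDeriv {p : ℂ → ℂ} (hv : IsHypergeometricSolution (1 - b) (1 - a) (2 - c) U v)
    (hU : IsOpen U) (h0 : 0 ∉ U) (h1 : 1 ∉ U)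
    (hp : ∀ z ∈ U, HasDerivAt p (p z * ((1 - c) / z - (c - a - b) / (1 - z))) z) :
    IsHypergeometricSolution a b c U (fun z => p z * v z) := by
  have hz0 : ∀ z ∈ U, z ≠ 0 := fun z hz h => h0 (h ▸ hz)
  have hz1 : ∀ z ∈ U, 1 - z ≠ 0 := fun z hz h => h1 (sub_eq_zero.mp h ▸ hz)
  set l : ℂ → ℂ := fun z => (1 - c) / z - (c - a - b) / (1 - z)
  have hl : ∀ z ∈ U, HasDerivAt l (-(1 - c) / z ^ 2 - (c - a - b) / (1 - z) ^ 2) z := by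
    intro z hz
    refine (((hasDerivAt_const z (1 - c)).div (hasDerivAt_id' z) (hz0 z hz)).sub
      ((hasDerivAt_const z (c - a - b)).div ((hasDerivAt_id' z).const_sub 1)
        (hz1 z hz))).congr_deriv ?_
    ring
  refine isHypergeometricSolution_of_hasDerivAt hU
    (fun z hz => (hp z hz).mul (hv.hasDerivAt hU hz))
    (fun z hz => (((hp z hz).mul (hl z hz)).mul (hv.hasDerivAt hU hz)).add
      ((hp z hz).mul (hv.hasDerivAt_deriv hU hz))) fun z hz => ?_
  have hz0 := hz0 z hz
  have hz1 := hz1 z hz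
  have ode := hv.2 z hz
  simp only [l, Pi.mul_apply]
  field_simp
  linear_combination p z * z * (1 - z) * ode

end IsHypergeometricSolution

lemma isHypergeometricSolution_lagrangePoly (a b : ℂ) (N : ℕ) (hU : IsOpen U) :
    IsHypergeometricSolution (-N) a (1 - b - N) U (fun z => lagrangePoly a b N z 1) := by
  have hderiv (a : ℂ) (n : ℕ) (z : ℂ) : HasDerivAt (fun z => lagrangePoly a b (n + 1) z 1)
      (a * lagrangePoly (a + 1) b n z 1) z := by
    simpa using hasDerivAt_lagrangePoly (hasDerivAt_id z) (hasDerivAt_const z (1 : ℂ))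
  match N with
  | 0 =>
    simp only [lagrangePoly_zero]
    exact isHypergeometricSolution_of_hasDerivAt hU (fun z _ => hasDerivAt_const z 1)
      (fun z _ => hasDerivAt_const z 0) fun z _ => by simp
  | 1 =>
    have h := hderiv a 0
    simp only [lagrangePoly_zero] at h
    refine isHypergeometricSolution_of_hasDerivAt hU (fun z _ => h z)
      (fun z _ => hasDerivAt_const z _) fun z _ => ?_
    have euler := succ_mul_lagrangePoly_succ a b 0 z 1
    simp only [lagrangePoly_zero] at euler
    push_cast at euler ⊢
    linear_combination a * euler
  | n + 2 =>
    refine isHypergeometricSolution_of_hasDerivAt hU (fun z _ => hderiv a (n + 1) z)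
      (fun z _ => (hderiv (a + 1) n z).const_mul a) fun z _ => ?_
    have euler := succ_mul_lagrangePoly_succ a b (n + 1) z 1
    have euler' := succ_mul_lagrangePoly_succ (a + 1) b n z 1
    have diff := lagrangePoly_add_one_right_sub_left a b n z 1
    push_cast at euler ⊢
    linear_combination a * euler - a * (1 - z) * euler' + a * b * diff

end HypergeometricEquation

section TerminatingSeries

lemma poch_eq_factorial_mul_multichoose (a : ℂ) (k : ℕ) :
    poch a k = k.factorial * Ring.multichoose a k := by
  rw [poch, ← nsmul_eq_mul, Ring.factorial_nsmul_multichoose_eq_ascPochhammer,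
    Polynomial.ascPochhammer_smeval_eq_eval]

lemma factorial_cast_ne_zero (k : ℕ) : (k.factorial : ℂ) ≠ 0 :=
  Nat.cast_ne_zero.mpr k.factorial_ne_zero

lemma poch_div_factorial (a : ℂ) (k : ℕ) : poch a k / k.factorial = Ring.multichoose a k := by
  rw [poch_eq_factorial_mul_multichoose, mul_div_cancel_left₀ _ (factorial_cast_ne_zero k)]

lemma multichoose_ne_zero {a : ℂ} {k : ℕ} (h : poch a k ≠ 0) : Ring.multichoose a k ≠ 0 :=
  right_ne_zero_of_mul (poch_eq_factorial_mul_multichoose a k ▸ h)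

lemma poch_one (k : ℕ) : poch 1 k = k.factorial := by
  rw [poch_eq_factorial_mul_multichoose, Ring.multichoose_one, mul_one]

lemma poch_add (a : ℂ) (j k : ℕ) : poch a (j + k) = poch a j * poch (a + j) k := by
  simp [poch, ← ascPochhammer_mul]

lemma factorial_add_eq_mul_poch (j k : ℕ) :
    ((j + k).factorial : ℂ) = j.factorial * poch (j + 1) k := by
  rw [← poch_one, poch_add, poch_one, add_comm (1 : ℂ)]

lemma multichoose_natCast_add_one_comm (j k : ℕ) :
    Ring.multichoose (j + 1 : ℂ) k = Ring.multichoose (k + 1 : ℂ) j := by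
  have h := factorial_add_eq_mul_poch j k
  rw [add_comm j k, factorial_add_eq_mul_poch k j] at h
  have hj := factorial_cast_ne_zero j
  have hk := factorial_cast_ne_zero k
  rw [← poch_div_factorial, ← poch_div_factorial]
  field_simp
  linear_combination -h

lemma poch_one_sub_sub (a : ℂ) (i j : ℕ) :
    poch (1 - a - (i + j)) i = (-1) ^ i * poch (a + j) i := by
  rw [show 1 - a - (i + j) = -(a + i + j - 1) by ring, poch,
    ascPochhammer_eval_neg_eq_descPochhammer, descPochhammer_eval_eq_ascPochhammer, poch]
  ring_nf

lemma hypTerm_eq_lagrangePoly {β : ℂ} {N : ℕ} (hβ : poch β N ≠ 0) (b z : ℂ) :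
    hypTerm N b (1 - β - N) z = (Ring.multichoose β N)⁻¹ * lagrangePoly b β N z 1 := by
  rw [hypTerm, ← Finset.Nat.sum_antidiagonal_eq_sum_range_succ_mk fun p : ℕ × ℕ =>
    poch (-N) p.1 * poch b p.1 / (poch (1 - β - N) p.1 * p.1.factorial) * z ^ p.1, lagrangePoly,
    Finset.mul_sum]
  refine Finset.sum_congr rfl fun ⟨i, j⟩ hij => ?_
  obtain rfl : j + i = N := (add_comm j i).trans (Finset.HasAntidiagonal.mem_antidiagonal.mp hij)
  have numerator : poch (-(j + i : ℕ)) i = (-1) ^ i * poch (j + 1) i := by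
    rw [add_comm (j : ℂ), ← poch_one_sub_sub]
    push_cast
    ring_nf
  have denominator : poch (1 - β - (j + i : ℕ)) i = (-1) ^ i * poch (β + j) i := by
    rw [← poch_one_sub_sub]
    push_cast
    ring_nf
  have hβj : poch β j ≠ 0 := left_ne_zero_of_mul (poch_add β j i ▸ hβ)
  have hβi : poch (β + j) i ≠ 0 := right_ne_zero_of_mul (poch_add β j i ▸ hβ)
  have h1i : poch (j + 1) i ≠ 0 :=
    right_ne_zero_of_mul (factorial_add_eq_mul_poch j i ▸ factorial_cast_ne_zero (j + i))
  have hj := factorial_cast_ne_zero j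
  rw [← poch_div_factorial, ← poch_div_factorial, ← poch_div_factorial, numerator, denominator,
    poch_add, factorial_add_eq_mul_poch]
  field_simp
  simp

lemma poch_div_poch_mul_hypTerm {β : ℂ} {N k : ℕ} (hβ : poch β (N + k) ≠ 0) (b z : ℂ) :
    poch (N + 1) k / poch (β + N) k * hypTerm N b (1 - β - N) z =
      (Ring.multichoose β (N + k))⁻¹ * lagrangePoly b β N z 1 := by
  have hβN : poch β N ≠ 0 := left_ne_zero_of_mul (poch_add β N k ▸ hβ)
  have hN := factorial_cast_ne_zero N
  rw [hypTerm_eq_lagrangePoly hβN, ← poch_div_factorial, ← poch_div_factorial, poch_add,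
    factorial_add_eq_mul_poch]
  field_simp

end TerminatingSeries

section GaussSeries

lemma poch_ne_zero {a : ℂ} {k : ℕ} (h : ∀ j < k, a + j ≠ 0) : poch a k ≠ 0 := by
  rw [poch, Ne, ascPochhammer_eval_eq_zero_iff]
  rintro ⟨j, hj, hja⟩
  exact h j hj (by rw [hja, add_neg_cancel])

lemma mul_poch_add_one (a : ℂ) (k : ℕ) : a * poch (a + 1) k = poch a k * (a + k) := by
  have poch_one_right (a : ℂ) : poch a 1 = a := by simp [poch]
  have h := (poch_add a 1 k).symm.trans ((congrArg (poch a) (add_comm 1 k)).trans (poch_add a k 1))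
  simpa only [poch_one_right, Nat.cast_one] using h

lemma one_le_radius_ordinaryHypergeometricSeries (a b c : ℂ) :
    1 ≤ (ordinaryHypergeometricSeries ℂ a b c).radius := by
  by_cases h : ∀ k : ℕ, (k : ℂ) ≠ -a ∧ (k : ℂ) ≠ -b ∧ (k : ℂ) ≠ -c
  · rw [ordinaryHypergeometricSeries_radius_eq_one ℂ a b c h]
  · simp only [ne_eq, ← not_or, not_forall, not_not] at h
    obtain ⟨k, h | h | h⟩ := h <;> rw [← neg_neg a, ← neg_neg b, ← neg_neg c, ← h]
    · rw [ordinaryHypergeometric_radius_top_of_neg_nat₁]; exact le_top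
    · rw [ordinaryHypergeometric_radius_top_of_neg_nat₂]; exact le_top
    · rw [ordinaryHypergeometric_radius_top_of_neg_nat₃]; exact le_top

lemma hasFPowerSeriesOnBall_ordinaryHypergeometric (a b c : ℂ) :
    HasFPowerSeriesOnBall (ordinaryHypergeometric a b c : ℂ → ℂ)
      (ordinaryHypergeometricSeries ℂ a b c) 0 1 :=
  have h := one_le_radius_ordinaryHypergeometricSeries a b c
  ((ordinaryHypergeometricSeries ℂ a b c).hasFPowerSeriesOnBall
    (one_pos.trans_le h)).mono one_pos h

lemma mem_eball_zero_one {E : Type*} [SeminormedAddCommGroup E] {w : E} :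
    w ∈ Metric.eball 0 1 ↔ ‖w‖ < 1 := by
  simp [← ENNReal.ofReal_one, Metric.eball_ofReal]

lemma differentiableAt_ordinaryHypergeometric (a b c : ℂ) {w : ℂ} (hw : ‖w‖ < 1) :
    DifferentiableAt ℂ (ordinaryHypergeometric a b c) w :=
  ((hasFPowerSeriesOnBall_ordinaryHypergeometric a b c).analyticAt_of_mem
    (mem_eball_zero_one.mpr hw)).differentiableAt

lemma hasSum_nsmul_fderiv {𝕜 E F : Type*} [NontriviallyNormedField 𝕜] [NormedAddCommGroup E]
    [NormedSpace 𝕜 E] [NormedAddCommGroup F] [NormedSpace 𝕜 F] [CompleteSpace F] {f : E → F}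
    {p : FormalMultilinearSeries 𝕜 E F} {x y : E} {r : ENNReal}
    (hf : HasFPowerSeriesOnBall f p x r) (hy : y ∈ Metric.eball 0 r) :
    HasSum (fun k => k • p k fun _ => y) (fderiv 𝕜 f (x + y) y) := by
  have h := (hf.fderiv.hasSum hy).mapL (ContinuousLinearMap.apply 𝕜 F y)
  simp only [ContinuousLinearMap.apply_apply, FormalMultilinearSeries.derivSeries_apply_diag] at h
  simpa using HasSum.zero_add (f := fun k => k • p k fun _ => y) h

lemma mul_deriv_ordinaryHypergeometric_add_one (a b : ℂ) {c w : ℂ} (hc : ∀ k : ℕ, c + k ≠ 0)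
    (hw : ‖w‖ < 1) :
    w * deriv (ordinaryHypergeometric a b (c + 1)) w =
      c * (ordinaryHypergeometric a b c w - ordinaryHypergeometric a b (c + 1) w) := by
  have hw' := mem_eball_zero_one.mpr hw
  have hasSum (c : ℂ) := (hasFPowerSeriesOnBall_ordinaryHypergeometric a b c).hasSum hw'
  have hasSum_deriv :=
    hasSum_nsmul_fderiv (hasFPowerSeriesOnBall_ordinaryHypergeometric a b (c + 1)) hw'
  have hasSum_sub := ((hasSum c).sub (hasSum (c + 1))).mul_left c
  simp only [zero_add, fderiv_eq_smul_deriv, smul_eq_mul] at hasSum_deriv hasSum_sub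
  refine hasSum_deriv.unique (hasSum_sub.congr_fun fun k => ?_)
  have hk : poch c k ≠ 0 := poch_ne_zero fun j _ => hc j
  have hk' : poch (c + 1) k ≠ 0 := poch_ne_zero fun j _ => by
    simpa [add_assoc, add_comm (1 : ℂ)] using hc (j + 1)
  have coeff : k * (poch (c + 1) k)⁻¹ = c * ((poch c k)⁻¹ - (poch (c + 1) k)⁻¹) := by
    field_simp
    linear_combination -mul_poch_add_one c k
  simp only [poch] at coeff
  simp only [ordinaryHypergeometricSeries_apply_eq, smul_eq_mul, nsmul_eq_mul]
  linear_combination (k.factorial : ℂ)⁻¹ * (ascPochhammer ℂ k).eval a *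
    (ascPochhammer ℂ k).eval b * w ^ k * coeff

lemma hasDerivAt_pow_succ_mul_ordinaryHypergeometric (a b : ℂ) (j : ℕ) {w : ℂ} (hw : ‖w‖ < 1) :
    HasDerivAt (fun w => w ^ (j + 1) * ordinaryHypergeometric a b (j + 2 : ℂ) w)
      ((j + 1) * w ^ j * ordinaryHypergeometric a b (j + 1 : ℂ) w) w := by
  have contiguous := mul_deriv_ordinaryHypergeometric_add_one a b (c := j + 1)
    (fun k => by norm_cast; lia) hw
  rw [show (j + 1 + 1 : ℂ) = j + 2 by ring] at contiguous
  refine ((hasDerivAt_pow (j + 1) w).mul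
    (differentiableAt_ordinaryHypergeometric a b (j + 2) hw).hasDerivAt).congr_deriv ?_
  push_cast
  linear_combination w ^ j * contiguous

lemma ordinaryHypergeometric_self_left {a : ℂ} (ha : ∀ k : ℕ, (k : ℂ) ≠ -a) (b : ℂ) {w : ℂ}
    (hw : ‖w‖ < 1) : ordinaryHypergeometric a b a w = (1 - w) ^ (-b) := by
  have binomial := Complex.one_add_cpow_hasFPowerSeriesOnBall_zero (a := -b)
  rw [binomialSeries_eq_ordinaryHypergeometricSeries ha, neg_neg,
    ordinaryHypergeometricSeries_symm] at binomial
  have h := binomial.sum (mem_eball_zero_one.mpr (norm_neg w ▸ hw))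
  rw [zero_add, ← sub_eq_add_neg] at h
  refine .trans (tsum_congr fun k => ?_) h.symm
  rw [FormalMultilinearSeries.compContinuousLinearMap_apply]
  simp [Function.comp_def]

end GaussSeries

section Continuation

lemma mem_slit_iff {w : ℂ} : w ∈ slit ↔ 1 - w ∈ Complex.slitPlane := by
  rw [Complex.mem_slitPlane_iff_not_le_zero, slit, mem_compl_iff, not_iff_not, mem_image]
  constructor
  · rintro ⟨x, hx, rfl⟩
    simpa [Complex.le_def] using hx
  · intro h
    obtain ⟨hre, him⟩ : 1 ≤ w.re ∧ w.im = 0 := by simpa [Complex.le_def] using h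
    exact ⟨w.re, hre, Complex.ext rfl him.symm⟩

lemma slit_eq_preimage : slit = Homeomorph.subLeft (1 : ℂ) ⁻¹' Complex.slitPlane :=
  Set.ext fun _ => mem_slit_iff

lemma isOpen_slit : IsOpen slit := by
  rw [slit_eq_preimage]
  exact Complex.isOpen_slitPlane.preimage (Homeomorph.continuous _)

lemma isPreconnected_slit : IsPreconnected slit := by
  rw [slit_eq_preimage, Homeomorph.isPreconnected_preimage]
  exact (Complex.starConvex_one_slitPlane.isPathConnected
    Complex.one_mem_slitPlane).isConnected.isPreconnected

lemma ball_subset_slit : Metric.ball 0 1 ⊆ slit := fun w hw => by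
  rw [mem_slit_iff, sub_eq_add_neg]
  exact Complex.mem_slitPlane_of_norm_lt_one (by simpa using hw)

lemma IsContinuation.eqOn {a b c : ℂ} {F G : ℂ → ℂ} (hF : IsContinuation a b c F)
    (hG : IsContinuation a b c G) : EqOn F G slit := by
  refine (hF.1.analyticOnNhd isOpen_slit).eqOn_of_preconnected_of_eventuallyEq
    (hG.1.analyticOnNhd isOpen_slit) isPreconnected_slit
    (ball_subset_slit (Metric.mem_ball_self one_pos)) ?_
  filter_upwards [Metric.ball_mem_nhds (0 : ℂ) one_pos] with w hw
  have hw' : ‖w‖ < 1 := by simpa using hw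
  rw [hF.2 w hw', hG.2 w hw']

lemma isContinuation_update {a b c : ℂ} {g : ℂ → ℂ}
    (hg : ∀ w ∈ slit, w ≠ 0 → DifferentiableAt ℂ g w)
    (h : ∀ w ≠ 0, ‖w‖ < 1 → g w = ordinaryHypergeometric a b c w) :
    IsContinuation a b c (Function.update g 0 1) := by
  have eq_gauss (w : ℂ) (hw : ‖w‖ < 1) :
      Function.update g 0 1 w = ordinaryHypergeometric a b c w := by
    rcases eq_or_ne w 0 with rfl | hw0
    · rw [Function.update_self, ordinaryHypergeometric_zero]
    · rw [Function.update_of_ne hw0, h w hw0 hw]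
  refine ⟨fun w hw => DifferentiableAt.differentiableWithinAt ?_, eq_gauss⟩
  rcases eq_or_ne w 0 with rfl | hw0
  · refine (differentiableAt_ordinaryHypergeometric a b c
      (norm_zero.trans_lt one_pos)).congr_of_eventuallyEq ?_
    filter_upwards [Metric.ball_mem_nhds (0 : ℂ) one_pos] with v hv
    exact eq_gauss v (by simpa using hv)
  · refine (hg w hw hw0).congr_of_eventuallyEq ?_
    filter_upwards [isOpen_ne.mem_nhds hw0] with v hv using Function.update_of_ne hv 1 g

lemma hasDerivAt_cpow_mul_pow (k : ℕ) (α : ℂ) {w : ℂ} (hw : 1 - w ∈ Complex.slitPlane) :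
    HasDerivAt (fun w => (1 - w) ^ α * (w - 1) ^ (k + 1))
      ((α + k + 1) * ((1 - w) ^ α * (w - 1) ^ k)) w := by
  have h0 := Complex.slitPlane_ne_zero hw
  refine ((((hasDerivAt_id' w).const_sub 1).cpow_const hw).mul
    (((hasDerivAt_id' w).sub_const 1).pow (k + 1))).congr_deriv ?_
  rw [Complex.cpow_sub _ _ h0, Complex.cpow_one]
  simp only [Pi.pow_apply, ← neg_sub 1 w, Nat.add_sub_cancel, pow_succ]
  push_cast
  field_simp
  ring

lemma hasDerivAt_cpow_mul_pow_mul_lagrangePoly (k m : ℕ) (α : ℂ) {w : ℂ}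
    (hw : 1 - w ∈ Complex.slitPlane) :
    HasDerivAt
      (fun w => (1 - w) ^ α * (w - 1) ^ (k + 1) * lagrangePoly (k + 1 : ℂ) (α + 1) m 1 w)
      ((α + k + 1 + m) * ((1 - w) ^ α * (w - 1) ^ k * lagrangePoly (k : ℂ) (α + 1) m 1 w)) w := by
  have hpow := hasDerivAt_cpow_mul_pow k α hw
  cases m with
  | zero => simpa only [lagrangePoly_zero, mul_one, Nat.cast_zero, add_zero] using hpow
  | succ m =>
    refine (hpow.mul (hasDerivAt_lagrangePoly (hasDerivAt_const w (1 : ℂ))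
      (hasDerivAt_id' w))).congr_deriv ?_
    have sum := mul_lagrangePoly_add_one (k : ℂ) (α + 1) (m + 1) 1 w
    have diff := lagrangePoly_add_one_right_sub_left (k : ℂ) (α + 1) m 1 w
    push_cast at sum ⊢
    linear_combination (1 - w) ^ α * (w - 1) ^ k * (sum - (α + 1) * diff)

/-- The function `(α + 1)_{m+n+1} / (m+n+1)! · w^{m+n+1} ₂F₁(m+1,-α;n+m+2;w)` in closed form. It
supplies the analytic continuation of the Gauss series from the unit disc to `slit`. -/
noncomputable def gaussNumerator (m n : ℕ) (α w : ℂ) : ℂ :=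
  lagrangePoly (m + 1 : ℂ) (α + 1) n (w - 1) w +
    (1 - w) ^ α * (w - 1) ^ (n + 1) * lagrangePoly (n + 1 : ℂ) (α + 1) m 1 w

lemma gaussNumerator_apply_zero (m n : ℕ) (α : ℂ) : gaussNumerator m n α 0 = 0 := by
  rw [gaussNumerator, lagrangePoly_swap, lagrangePoly_apply_zero_left, lagrangePoly_swap,
    lagrangePoly_apply_zero_left, multichoose_natCast_add_one_comm]
  simp only [zero_sub, sub_zero, Complex.one_cpow, one_pow]
  ring

lemma hasDerivAt_gaussNumerator_zero (m : ℕ) (α : ℂ) {w : ℂ} (hw : w ∈ slit) :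
    HasDerivAt (gaussNumerator m 0 α)
      ((α + 1 + m) * Ring.multichoose (α + 1) m * w ^ m * (1 - w) ^ α) w := by
  have h := (hasDerivAt_cpow_mul_pow_mul_lagrangePoly 0 m α (mem_slit_iff.mp hw)).const_add 1
  simp only [Nat.cast_zero, lagrangePoly_zero_left] at h
  unfold gaussNumerator
  simp only [lagrangePoly_zero, Nat.cast_zero]
  exact h.congr_deriv (by ring)

lemma hasDerivAt_gaussNumerator_succ (m n : ℕ) (α : ℂ) {w : ℂ} (hw : w ∈ slit) :
    HasDerivAt (gaussNumerator m (n + 1) α) ((α + m + n + 2) * gaussNumerator m n α w) w := by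
  have h₁ := hasDerivAt_lagrangePoly (a := (m : ℂ) + 1) (b := α + 1) (n := n)
    ((hasDerivAt_id' w).sub_const 1) (hasDerivAt_id' w)
  have h₂ := hasDerivAt_cpow_mul_pow_mul_lagrangePoly (n + 1) m α (mem_slit_iff.mp hw)
  refine (h₁.add h₂).congr_deriv ?_
  rw [gaussNumerator]
  push_cast
  linear_combination mul_lagrangePoly_add_one ((m : ℂ) + 1) (α + 1) n (w - 1) w

lemma differentiableAt_gaussNumerator (m n : ℕ) (α : ℂ) {w : ℂ} (hw : w ∈ slit) :
    DifferentiableAt ℂ (gaussNumerator m n α) w :=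
  match n with
  | 0 => (hasDerivAt_gaussNumerator_zero m α hw).differentiableAt
  | n + 1 => (hasDerivAt_gaussNumerator_succ m n α hw).differentiableAt

lemma eqOn_gaussNumerator_of_hasDerivAt {m n : ℕ} {α : ℂ}
    (h : ∀ w : ℂ, ‖w‖ < 1 → HasDerivAt (gaussNumerator m n α)
      (Ring.multichoose (α + 1) (m + n + 1) * ((m + n + 1) * w ^ (m + n) *
        ordinaryHypergeometric (m + 1 : ℂ) (-α) (m + n + 1 : ℂ) w)) w) :
    EqOn (gaussNumerator m n α) (fun w => Ring.multichoose (α + 1) (m + n + 1) *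
      (w ^ (m + n + 1) * ordinaryHypergeometric (m + 1 : ℂ) (-α) (m + n + 2 : ℂ) w))
      (Metric.ball 0 1) := by
  have hgauss (w : ℂ) (hw : ‖w‖ < 1) :=
    (hasDerivAt_pow_succ_mul_ordinaryHypergeometric (m + 1) (-α) (m + n) hw).const_mul
      (Ring.multichoose (α + 1) (m + n + 1))
  push_cast at hgauss
  simp only [← mem_ball_zero_iff] at h hgauss
  exact Metric.isOpen_ball.eqOn_of_deriv_eq (convex_ball 0 1).isPreconnected
    (fun w hw => (h w hw).differentiableAt.differentiableWithinAt)
    (fun w hw => (hgauss w hw).differentiableAt.differentiableWithinAt)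
    (fun w hw => (h w hw).deriv.trans (hgauss w hw).deriv.symm)
    (Metric.mem_ball_self one_pos) (by simp [gaussNumerator_apply_zero])

lemma eqOn_gaussNumerator (m n : ℕ) (α : ℂ) :
    EqOn (gaussNumerator m n α) (fun w => Ring.multichoose (α + 1) (m + n + 1) *
      (w ^ (m + n + 1) * ordinaryHypergeometric (m + 1 : ℂ) (-α) (m + n + 2 : ℂ) w))
      (Metric.ball 0 1) := by
  induction n with
  | zero =>
    refine eqOn_gaussNumerator_of_hasDerivAt fun w hw => ?_
    have binomial : ordinaryHypergeometric (m + 1 : ℂ) (-α) (m + 1 : ℂ) w = (1 - w) ^ α := by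
      have h0 (k : ℕ) : (k : ℂ) ≠ -(m + 1) := fun h => by norm_cast at h
      simpa using ordinaryHypergeometric_self_left h0 (-α) hw
    refine (hasDerivAt_gaussNumerator_zero m α
      (ball_subset_slit (mem_ball_zero_iff.mpr hw))).congr_deriv ?_
    simp only [Nat.cast_zero, add_zero]
    rw [binomial]
    linear_combination -w ^ m * (1 - w) ^ α * succ_mul_multichoose_succ (α + 1) m
  | succ n ih =>
    refine eqOn_gaussNumerator_of_hasDerivAt fun w hw => ?_
    have hw' := mem_ball_zero_iff.mpr hw
    refine (hasDerivAt_gaussNumerator_succ m n α (ball_subset_slit hw')).congr_deriv ?_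
    have hchoose := succ_mul_multichoose_succ (α + 1) (m + n + 1)
    rw [ih hw', show (m + (n + 1 : ℕ) + 1 : ℂ) = m + n + 2 by push_cast; ring]
    push_cast at hchoose ⊢
    linear_combination -w ^ (m + n + 1) *
      ordinaryHypergeometric (m + 1 : ℂ) (-α) (m + n + 2 : ℂ) w * hchoose

lemma exists_isContinuation (m n : ℕ) {α : ℂ} (hα : poch (α + 1) (m + n + 1) ≠ 0) :
    ∃ F, IsContinuation (m + 1) (-α) (n + m + 2) F ∧ ∀ w ≠ 0, F w =
      gaussNumerator m n α w / (Ring.multichoose (α + 1) (m + n + 1) * w ^ (m + n + 1)) := by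
  have hchoose := multichoose_ne_zero hα
  refine ⟨_, isContinuation_update (g := fun w =>
    gaussNumerator m n α w / (Ring.multichoose (α + 1) (m + n + 1) * w ^ (m + n + 1)))
    (fun w hw hw0 => ?_) (fun w hw0 hw => ?_), fun w hw0 => Function.update_of_ne hw0 _ _⟩
  · exact (differentiableAt_gaussNumerator m n α hw).div (by fun_prop)
      (mul_ne_zero hchoose (pow_ne_zero _ hw0))
  · rw [eqOn_gaussNumerator m n α (mem_ball_zero_iff.mpr hw), add_comm (n : ℂ)]
    field_simp

lemma isContinuation_hyp (m n : ℕ) {α : ℂ} (hα : poch (α + 1) (m + n + 1) ≠ 0) :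
    IsContinuation (m + 1) (-α) (n + m + 2) (hyp (m + 1) (-α) (n + m + 2)) :=
  have ⟨F, hF, _⟩ := exists_isContinuation m n hα
  Classical.epsilon_spec ⟨F, hF⟩

lemma hyp_eq_gaussNumerator_div (m n : ℕ) {α w : ℂ} (hα : poch (α + 1) (m + n + 1) ≠ 0)
    (hw : w ∈ slit) (hw0 : w ≠ 0) : hyp (m + 1) (-α) (n + m + 2) w =
      gaussNumerator m n α w / (Ring.multichoose (α + 1) (m + n + 1) * w ^ (m + n + 1)) := by
  obtain ⟨F, hF, hF'⟩ := exists_isContinuation m n hα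
  rw [← hF' w hw0, (isContinuation_hyp m n hα).eqOn hF hw]

end Continuation

section ThreeTermIdentity

lemma isOpen_cutPlane : IsOpen cutPlane :=
  (isCompact_Icc.image Complex.continuous_ofReal).isClosed.isOpen_compl

lemma zero_notMem_cutPlane : 0 ∉ cutPlane := fun h => h ⟨0, by simp⟩

lemma one_notMem_cutPlane : 1 ∉ cutPlane := fun h => h ⟨1, by simp⟩

variable {z : ℂ}

lemma ne_zero_of_mem_cutPlane (hz : z ∈ cutPlane) : z ≠ 0 :=
  ne_of_mem_of_not_mem hz zero_notMem_cutPlane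

lemma one_sub_ne_zero_of_mem_cutPlane (hz : z ∈ cutPlane) : 1 - z ≠ 0 :=
  sub_ne_zero.mpr (ne_of_mem_of_not_mem hz one_notMem_cutPlane).symm

lemma inv_mem_slit (hz : z ∈ cutPlane) : z⁻¹ ∈ slit := by
  rintro ⟨x, hx, hxz⟩
  exact hz ⟨x⁻¹, ⟨inv_nonneg.mpr (zero_le_one.trans hx), inv_le_one_of_one_le₀ hx⟩,
    by rw [Complex.ofReal_inv, hxz, inv_inv]⟩

lemma one_sub_inv_mem_slitPlane (hz : z ∈ cutPlane) : 1 - z⁻¹ ∈ Complex.slitPlane :=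
  mem_slit_iff.mp (inv_mem_slit hz)

lemma zpow_neg_sub_one {G : Type*} [DivisionMonoid G] (x : G) (n : ℕ) :
    x ^ (-(n : ℤ) - 1) = (x ^ (n + 1))⁻¹ := by
  rw [← zpow_natCast, ← zpow_neg]
  push_cast
  ring_nf

/-- The left-hand side of the three-term identity, for complex `α`. -/
noncomputable def gaussTerm (m n : ℕ) (α z : ℂ) : ℂ :=
  (1 - z) ^ (-(n : ℤ) - 1) * (1 - z⁻¹) ^ (-α) * hyp (m + 1) (-α) (n + m + 2) z⁻¹

/-- The summand of the three-term identity which is a series in powers of `1 - z`, for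
complex `α`. -/
noncomputable def reflectedTerm (m n : ℕ) (α z : ℂ) : ℂ :=
  poch (n + 1) (m + 1) / poch (n + α + 1) (m + 1) *
    z ^ (m + 1) * (1 - z) ^ (-(n : ℤ) - 1) * (1 - z⁻¹) ^ (-α) * hypTerm n (m + 1) (-n - α) (1 - z)

/-- The polynomial summand of the three-term identity, for complex `α`. -/
noncomputable def polynomialTerm (m n : ℕ) (α z : ℂ) : ℂ :=
  poch (m + 1) (n + 1) / poch (m + α + 1) (n + 1) * hypTerm m (n + 1) (-m - α) z

/-- A branch on `cutPlane` of the factor `z ^ (1 - c) * (1 - z) ^ (c - a - b)` which maps solutions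
of the hypergeometric equation with parameters `1 - b, 1 - a; 2 - c` to solutions of the one with
parameters `a, b; c`, for `(a, b, c) = (-m, n + 1, -m - α)`. -/
noncomputable def cutPlaneFactor (m n : ℕ) (α z : ℂ) : ℂ :=
  z ^ (m + 1) / (1 - z) ^ (n + 1) * (1 - z⁻¹) ^ (-α)

variable {m n : ℕ} {α : ℂ}

lemma reflectedTerm_eq_lagrangePoly (hα : poch (α + 1) (m + n + 1) ≠ 0) (z : ℂ) :
    reflectedTerm m n α z = (Ring.multichoose (α + 1) (m + n + 1))⁻¹ *
      (cutPlaneFactor m n α z * lagrangePoly (m + 1 : ℂ) (α + 1) n (1 - z) 1) := by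
  rw [show m + n + 1 = n + (m + 1) by ring] at hα ⊢
  have h := poch_div_poch_mul_hypTerm hα (m + 1) (1 - z)
  rw [show 1 - (α + 1) - n = -n - α by ring, show α + 1 + n = n + α + 1 by ring] at h
  rw [reflectedTerm, cutPlaneFactor, zpow_neg_sub_one]
  linear_combination z ^ (m + 1) / (1 - z) ^ (n + 1) * (1 - z⁻¹) ^ (-α) * h

lemma polynomialTerm_eq_lagrangePoly (hα : poch (α + 1) (m + n + 1) ≠ 0) (z : ℂ) :
    polynomialTerm m n α z = (Ring.multichoose (α + 1) (m + n + 1))⁻¹ *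
      lagrangePoly (n + 1 : ℂ) (α + 1) m z 1 := by
  rw [polynomialTerm, add_assoc m n 1, ← poch_div_poch_mul_hypTerm (add_assoc m n 1 ▸ hα),
    show 1 - (α + 1) - m = -m - α by ring, show α + 1 + m = m + α + 1 by ring]

lemma pow_mul_gaussNumerator_inv (hz : z ≠ 0) : z ^ (m + n + 1) * gaussNumerator m n α z⁻¹ =
    z ^ (m + 1) * lagrangePoly (m + 1 : ℂ) (α + 1) n (1 - z) 1 +
      (1 - z⁻¹) ^ α * (1 - z) ^ (n + 1) * lagrangePoly (n + 1 : ℂ) (α + 1) m z 1 := by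
  have h₁ := lagrangePoly_smul (m + 1 : ℂ) (α + 1) n z (z⁻¹ - 1) z⁻¹
  have h₂ := lagrangePoly_smul (n + 1 : ℂ) (α + 1) m z 1 z⁻¹
  have hpow : (1 - z) ^ (n + 1) = z ^ (n + 1) * (z⁻¹ - 1) ^ (n + 1) := by
    rw [← mul_pow, mul_sub, mul_inv_cancel₀ hz, mul_one]
  rw [mul_sub, mul_inv_cancel₀ hz, mul_one] at h₁
  rw [mul_inv_cancel₀ hz, mul_one] at h₂
  rw [gaussNumerator, h₁, h₂, hpow]
  ring

theorem gaussTerm_eq_add (hα : poch (α + 1) (m + n + 1) ≠ 0) (hz : z ∈ cutPlane) :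
    gaussTerm m n α z = reflectedTerm m n α z + polynomialTerm m n α z := by
  have hz0 := ne_zero_of_mem_cutPlane hz
  have hz1 := one_sub_ne_zero_of_mem_cutPlane hz
  have hpow : (1 - z⁻¹) ^ α ≠ 0 :=
    Complex.cpow_ne_zero_iff.mpr (.inl (Complex.slitPlane_ne_zero (one_sub_inv_mem_slitPlane hz)))
  have hyp_eq : hyp (m + 1) (-α) (n + m + 2) z⁻¹ =
      (Ring.multichoose (α + 1) (m + n + 1))⁻¹ * (z ^ (m + n + 1) * gaussNumerator m n α z⁻¹) := by
    rw [hyp_eq_gaussNumerator_div m n hα (inv_mem_slit hz) (inv_ne_zero hz0), inv_pow,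
      div_mul_eq_div_div, div_inv_eq_mul]
    ring
  rw [reflectedTerm_eq_lagrangePoly hα, polynomialTerm_eq_lagrangePoly hα, gaussTerm, hyp_eq,
    pow_mul_gaussNumerator_inv hz0, cutPlaneFactor, zpow_neg_sub_one, Complex.cpow_neg]
  generalize (1 - z⁻¹) ^ α = p at hpow
  field_simp

end ThreeTermIdentity

section DifferentialEquation

variable {m n : ℕ} {α : ℂ}

lemma hasDerivAt_cutPlaneFactor (m n : ℕ) (α : ℂ) {z : ℂ} (hz : z ∈ cutPlane) :
    HasDerivAt (cutPlaneFactor m n α) (cutPlaneFactor m n α z *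
      ((1 - (-m - α)) / z - (-m - α - -m - (n + 1)) / (1 - z))) z := by
  have hz0 := ne_zero_of_mem_cutPlane hz
  have hz1 := one_sub_ne_zero_of_mem_cutPlane hz
  have hs := one_sub_inv_mem_slitPlane hz
  have hs0 := Complex.slitPlane_ne_zero hs
  have hcpow : HasDerivAt (fun z : ℂ => (1 - z⁻¹) ^ (-α))
      ((1 - z⁻¹) ^ (-α) * (α / (z * (1 - z)))) z := by
    refine (((hasDerivAt_inv hz0).const_sub 1).cpow_const hs).congr_deriv ?_
    rw [Complex.cpow_sub _ _ hs0, Complex.cpow_one,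
      show 1 - z⁻¹ = -((1 - z) / z) by field_simp; ring]
    generalize (-((1 - z) / z)) ^ (-α) = p
    field_simp
  have hpow := (hasDerivAt_pow (m + 1) z).fun_div
    (((hasDerivAt_id' z).const_sub 1).fun_pow (n + 1)) (pow_ne_zero (n + 1) hz1)
  refine (hpow.mul hcpow).congr_deriv ?_
  rw [cutPlaneFactor]
  generalize (1 - z⁻¹) ^ (-α) = p
  push_cast
  simp only [pow_succ]
  field_simp
  ring

lemma isHypergeometricSolution_polynomialTerm (hα : poch (α + 1) (m + n + 1) ≠ 0) :
    IsHypergeometricSolution (-m) (n + 1) (-m - α) cutPlane (polynomialTerm m n α) := by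
  have h := isHypergeometricSolution_lagrangePoly (n + 1) (α + 1) m isOpen_cutPlane
  rw [show 1 - (α + 1) - m = -m - α by ring] at h
  exact (h.const_mul isOpen_cutPlane _).congr isOpen_cutPlane
    fun z _ => polynomialTerm_eq_lagrangePoly hα z

lemma isHypergeometricSolution_reflectedTerm (hα : poch (α + 1) (m + n + 1) ≠ 0) :
    IsHypergeometricSolution (-m) (n + 1) (-m - α) cutPlane (reflectedTerm m n α) := by
  have h : IsHypergeometricSolution (1 - (n + 1)) (1 - -m) (2 - (-m - α)) cutPlane
      (fun z => lagrangePoly (m + 1 : ℂ) (α + 1) n (1 - z) 1) := by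
    convert ((isHypergeometricSolution_lagrangePoly (m + 1) (α + 1) n
      isOpen_univ).comp_one_sub isOpen_univ).mono (subset_univ _) using 1 <;> ring
  exact ((h.mul_of_logDeriv isOpen_cutPlane zero_notMem_cutPlane one_notMem_cutPlane
    fun z hz => hasDerivAt_cutPlaneFactor m n α hz).const_mul isOpen_cutPlane _).congr
    isOpen_cutPlane fun z _ => reflectedTerm_eq_lagrangePoly hα z

lemma isHypergeometricSolution_gaussTerm (hα : poch (α + 1) (m + n + 1) ≠ 0) :
    IsHypergeometricSolution (-m) (n + 1) (-m - α) cutPlane (gaussTerm m n α) :=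
  ((isHypergeometricSolution_reflectedTerm hα).add (isHypergeometricSolution_polynomialTerm hα)
    isOpen_cutPlane).congr isOpen_cutPlane fun _ => gaussTerm_eq_add hα

end DifferentialEquation

section LimitIdentity

variable {m n : ℕ}

lemma continuous_poch (k : ℕ) : Continuous fun a => poch a k :=
  (ascPochhammer ℂ k).continuous

lemma continuous_multichoose (k : ℕ) : Continuous fun a : ℂ => Ring.multichoose a k := by
  simp only [← poch_div_factorial]
  exact (continuous_poch k).div_const _

lemma continuous_lagrangePoly_right (a : ℂ) (k : ℕ) (x y : ℂ) :
    Continuous fun b => lagrangePoly a b k x y :=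
  continuous_finsetSum _ fun p _ =>
    ((continuous_const.mul (continuous_multichoose p.2)).mul_const _).mul_const _

lemma eventually_poch_add_one_ne_zero {α : ℂ} {k : ℕ} (hα : poch (α + 1) k ≠ 0) :
    ∀ᶠ β in 𝓝 α, poch (β + 1) k ≠ 0 :=
  ((continuous_poch k).comp (continuous_add_const 1)).continuousAt.eventually_ne hα

lemma continuousAt_inv_multichoose {α : ℂ} {k : ℕ} (hα : poch (α + 1) k ≠ 0) :
    ContinuousAt (fun β : ℂ => (Ring.multichoose (β + 1) k)⁻¹) α :=
  ((continuous_multichoose k).comp (continuous_add_const 1)).continuousAt.inv₀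
    (multichoose_ne_zero hα)

lemma continuousAt_polynomialTerm {α : ℂ} (hα : poch (α + 1) (m + n + 1) ≠ 0) (z : ℂ) :
    ContinuousAt (fun α => polynomialTerm m n α z) α := by
  refine ((continuousAt_inv_multichoose hα).mul ((continuous_lagrangePoly_right (n + 1) m z 1).comp
    (continuous_add_const 1)).continuousAt).congr ?_
  filter_upwards [eventually_poch_add_one_ne_zero hα] with β hβ
  exact (polynomialTerm_eq_lagrangePoly hβ z).symm

lemma continuousAt_reflectedTerm {α z : ℂ} (hα : poch (α + 1) (m + n + 1) ≠ 0)
    (hz : z ∈ cutPlane) : ContinuousAt (fun α => reflectedTerm m n α z) α := by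
  have hfactor : ContinuousAt (fun α => cutPlaneFactor m n α z) α :=
    continuousAt_const.mul (continuousAt_id.neg.const_cpow
      (.inl (Complex.slitPlane_ne_zero (one_sub_inv_mem_slitPlane hz))))
  refine ((continuousAt_inv_multichoose hα).mul (hfactor.mul
    ((continuous_lagrangePoly_right (m + 1) n (1 - z) 1).comp
      (continuous_add_const 1)).continuousAt)).congr ?_
  filter_upwards [eventually_poch_add_one_ne_zero hα] with β hβ
  exact (reflectedTerm_eq_lagrangePoly hβ z).symm

lemma continuousAt_gaussTerm {α z : ℂ} (hα : poch (α + 1) (m + n + 1) ≠ 0)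
    (hz : z ∈ cutPlane) : ContinuousAt (fun α => gaussTerm m n α z) α := by
  refine ((continuousAt_reflectedTerm hα hz).add (continuousAt_polynomialTerm hα z)).congr ?_
  filter_upwards [eventually_poch_add_one_ne_zero hα] with β hβ
  exact (gaussTerm_eq_add hβ hz).symm

lemma poch_zero_add_one_ne_zero (k : ℕ) : poch (0 + 1) k ≠ 0 := by
  rw [zero_add, poch_one]
  exact factorial_cast_ne_zero k

lemma ordinaryHypergeometric_zero_right (a c w : ℂ) : ordinaryHypergeometric a 0 c w = 1 := by
  rw [ordinaryHypergeometric_eq_tsum]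
  refine (tsum_eq_single 0 fun k hk => ?_).trans (by simp)
  simp [hk]

lemma hyp_neg_zero {w : ℂ} (hw : w ∈ slit) : hyp (m + 1) (-0) (n + m + 2) w = 1 :=
  (isContinuation_hyp m n (poch_zero_add_one_ne_zero _)).eqOn (G := fun _ => 1)
    ⟨differentiableOn_const 1, fun w _ => by rw [neg_zero, ordinaryHypergeometric_zero_right]⟩ hw

lemma gaussTerm_zero {z : ℂ} (hz : z ∈ cutPlane) : gaussTerm m n 0 z = leftTerm₀ n z := by
  rw [gaussTerm, hyp_neg_zero (inv_mem_slit hz), neg_zero, Complex.cpow_zero, mul_one, mul_one,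
    leftTerm₀]

lemma reflectedTerm_zero {z : ℂ} (hz : z ∈ cutPlane) :
    reflectedTerm m n 0 z = rightTerm₁₀ m n z := by
  have hz1 := one_sub_ne_zero_of_mem_cutPlane hz
  rw [reflectedTerm_eq_lagrangePoly (poch_zero_add_one_ne_zero _), cutPlaneFactor, zero_add,
    Ring.multichoose_one, lagrangePoly_one_right_apply_one, neg_zero, Complex.cpow_zero, inv_one,
    one_mul, mul_one, div_mul_eq_mul_div, mul_div_assoc, Finset.sum_div, rightTerm₁₀]
  simp only [poch_div_factorial]
  congr! 2 with k
  rw [show (k : ℤ) - n - 1 = k + (-n - 1) by ring, zpow_add₀ hz1, zpow_natCast, zpow_neg_sub_one]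
  ring

lemma polynomialTerm_zero (z : ℂ) : polynomialTerm m n 0 z = rightTerm₂₀ m n z := by
  rw [polynomialTerm_eq_lagrangePoly (poch_zero_add_one_ne_zero _), zero_add,
    Ring.multichoose_one, lagrangePoly_one_right_apply_one, inv_one, one_mul, rightTerm₂₀]
  simp only [poch_div_factorial]

lemma differentiableAt_one_sub_zpow {𝕜 : Type*} [NontriviallyNormedField 𝕜] {x : 𝕜} (hx : x ≠ 1)
    (k : ℤ) : DifferentiableAt 𝕜 (fun x => (1 - x) ^ k) x :=
  .zpow (by fun_prop) (.inl (sub_ne_zero.mpr hx.symm))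

theorem leftTerm₀_eq_add {x : ℂ} (hx : x ≠ 1) :
    leftTerm₀ n x = rightTerm₂₀ m n x + rightTerm₁₀ m n x := by
  have hleft : DifferentiableOn ℂ (leftTerm₀ n) {1}ᶜ := fun x hx =>
    (differentiableAt_one_sub_zpow hx _).differentiableWithinAt
  have hright : DifferentiableOn ℂ (fun x => rightTerm₂₀ m n x + rightTerm₁₀ m n x) {1}ᶜ := by
    refine fun x hx => DifferentiableAt.differentiableWithinAt ?_
    unfold rightTerm₂₀ rightTerm₁₀
    have := differentiableAt_one_sub_zpow hx
    fun_prop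
  have two_mem : (2 : ℂ) ∈ cutPlane := by
    rintro ⟨x, hx, h2⟩
    linarith [hx.2, Complex.ofReal_injective (h2.trans (Complex.ofReal_ofNat 2).symm)]
  refine (hleft.analyticOnNhd isOpen_compl_singleton).eqOn_of_preconnected_of_eventuallyEq
    (hright.analyticOnNhd isOpen_compl_singleton)
    (isConnected_compl_singleton_of_one_lt_rank (by simp) 1).isPreconnected
    (z₀ := 2) (by simp) ?_ hx
  filter_upwards [isOpen_cutPlane.mem_nhds two_mem] with z hz
  rw [← gaussTerm_zero (m := m) hz, ← reflectedTerm_zero hz, ← polynomialTerm_zero,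
    gaussTerm_eq_add (poch_zero_add_one_ne_zero _) hz, add_comm]

lemma poch_ofReal_add_one_ne_zero {α : ℝ} (hα : 0 < α) (k : ℕ) : poch ((α : ℂ) + 1) k ≠ 0 :=
  poch_ne_zero fun j _ => by exact_mod_cast (by positivity : α + 1 + j ≠ 0)

end LimitIdentity

end ChaundyBullard

theorem mainTheorem5_general (m n : ℕ) :
    (∀ α : ℂ, poch (α + 1) (m + n + 1) ≠ 0 →
      (IsContinuation (m + 1) (-α) (n + m + 2) (hyp (m + 1) (-α) (n + m + 2)) ∧
        ∀ F : ℂ → ℂ, IsContinuation (m + 1) (-α) (n + m + 2) F →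
          EqOn F (hyp (m + 1) (-α) (n + m + 2)) slit) ∧
      (∀ z ∈ cutPlane, gaussTerm m n α z = reflectedTerm m n α z + polynomialTerm m n α z) ∧
      IsHypergeometricSolution (-m) (n + 1) (-m - α) cutPlane (gaussTerm m n α) ∧
      IsHypergeometricSolution (-m) (n + 1) (-m - α) cutPlane (reflectedTerm m n α) ∧
      IsHypergeometricSolution (-m) (n + 1) (-m - α) cutPlane (polynomialTerm m n α)) ∧
    (∀ z ∈ cutPlane,
      Tendsto (fun α => gaussTerm m n α z) (𝓝 0) (𝓝 (leftTerm₀ n z)) ∧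
      Tendsto (fun α => reflectedTerm m n α z) (𝓝 0) (𝓝 (rightTerm₁₀ m n z)) ∧
      Tendsto (fun α => polynomialTerm m n α z) (𝓝 0) (𝓝 (rightTerm₂₀ m n z))) ∧
    (∀ x : ℂ, x ≠ 1 → leftTerm₀ n x = rightTerm₂₀ m n x + rightTerm₁₀ m n x) ∧
    IsHypergeometricSolution (-m) (n + 1) (-m) cutPlane (leftTerm₀ n) ∧
    IsHypergeometricSolution (-m) (n + 1) (-m) cutPlane (rightTerm₁₀ m n) ∧
    IsHypergeometricSolution (-m) (n + 1) (-m) cutPlane (rightTerm₂₀ m n) := by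
  have h0 := poch_zero_add_one_ne_zero (m + n + 1)
  refine ⟨fun α hα => ⟨⟨isContinuation_hyp m n hα, fun F hF => hF.eqOn (isContinuation_hyp m n hα)⟩,
    fun z => gaussTerm_eq_add hα, isHypergeometricSolution_gaussTerm hα,
    isHypergeometricSolution_reflectedTerm hα, isHypergeometricSolution_polynomialTerm hα⟩,
    fun z hz => ⟨?_, ?_, ?_⟩, fun x => leftTerm₀_eq_add, ?_, ?_, ?_⟩
  · exact gaussTerm_zero hz ▸ continuousAt_gaussTerm h0 hz
  · exact reflectedTerm_zero hz ▸ continuousAt_reflectedTerm h0 hz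
  · exact polynomialTerm_zero z ▸ continuousAt_polynomialTerm h0 z
  · simpa only [sub_zero] using (isHypergeometricSolution_gaussTerm h0).congr isOpen_cutPlane
      fun z hz => (gaussTerm_zero hz).symm
  · simpa only [sub_zero] using (isHypergeometricSolution_reflectedTerm h0).congr isOpen_cutPlane
      fun z hz => (reflectedTerm_zero hz).symm
  · simpa only [sub_zero] using (isHypergeometricSolution_polynomialTerm h0).congr isOpen_cutPlane
      fun z _ => (polynomialTerm_zero z).symm

theorem mainTheorem5 (m n : ℕ) :
    -- for every `α > 0`:
    (∀ α : ℝ, 0 < α →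
      -- the analytic continuation of `₂F₁(m+1,-α;n+m+2;·)` to `ℂ ∖ [1,∞)` exists and is unique
      (IsContinuation ((m : ℂ) + 1) (-(α : ℂ)) ((n : ℂ) + m + 2)
          (hyp ((m : ℂ) + 1) (-(α : ℂ)) ((n : ℂ) + m + 2)) ∧
        ∀ F : ℂ → ℂ, IsContinuation ((m : ℂ) + 1) (-(α : ℂ)) ((n : ℂ) + m + 2) F →
          Set.EqOn F (hyp ((m : ℂ) + 1) (-(α : ℂ)) ((n : ℂ) + m + 2)) slit) ∧
      -- the three-term identity
      (∀ z ∈ cutPlane,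
        (1 - z) ^ (-(n : ℤ) - 1) * (1 - z⁻¹) ^ (-(α : ℂ)) *
            hyp ((m : ℂ) + 1) (-(α : ℂ)) ((n : ℂ) + m + 2) z⁻¹
          = poch ((n : ℂ) + 1) (m + 1) / poch ((n : ℂ) + α + 1) (m + 1) *
              z ^ (m + 1) * (1 - z) ^ (-(n : ℤ) - 1) * (1 - z⁻¹) ^ (-(α : ℂ)) *
              hypTerm n ((m : ℂ) + 1) (-(n : ℂ) - α) (1 - z)
            + poch ((m : ℂ) + 1) (n + 1) / poch ((m : ℂ) + α + 1) (n + 1) *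
              hypTerm m ((n : ℂ) + 1) (-(m : ℂ) - α) z) ∧
      -- its three terms solve the same hypergeometric differential equation
      SolvesODE m n α cutPlane (leftTerm m n α) ∧
      SolvesODE m n α cutPlane (rightTerm₁ m n α) ∧
      SolvesODE m n α cutPlane (rightTerm₂ m n α)) ∧
    -- as `α ↓ 0`, each of the three terms tends to the corresponding term of the limit identity
    (∀ z ∈ cutPlane,
      Filter.Tendsto (fun α : ℝ => leftTerm m n α z) (nhdsWithin 0 (Set.Ioi 0))
        (nhds (leftTerm₀ n z)) ∧
      Filter.Tendsto (fun α : ℝ => rightTerm₁ m n α z) (nhdsWithin 0 (Set.Ioi 0))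
        (nhds (rightTerm₁₀ m n z)) ∧
      Filter.Tendsto (fun α : ℝ => rightTerm₂ m n α z) (nhdsWithin 0 (Set.Ioi 0))
        (nhds (rightTerm₂₀ m n z))) ∧
    -- the limit identity
    (∀ x : ℂ, x ≠ 1 →
      (1 - x) ^ (-(n : ℤ) - 1)
        = ∑ k ∈ Finset.range (m + 1), poch ((n : ℂ) + 1) k / (k.factorial : ℂ) * x ^ k
          + x ^ (m + 1) * ∑ k ∈ Finset.range (n + 1),
              poch ((m : ℂ) + 1) k / (k.factorial : ℂ) * (1 - x) ^ ((k : ℤ) - n - 1)) ∧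
    -- the three limit terms solve the limit `α = 0` of the differential equation
    SolvesODE m n 0 cutPlane (leftTerm₀ n) ∧
    SolvesODE m n 0 cutPlane (rightTerm₁₀ m n) ∧
    SolvesODE m n 0 cutPlane (rightTerm₂₀ m n) := by
  obtain ⟨identity, limits, limit_identity, limit_solutions⟩ := mainTheorem5_general m n
  have tendsto_ofReal : Tendsto Complex.ofReal (𝓝[>] 0) (𝓝 0) :=
    Complex.continuous_ofReal.continuousAt.mono_left nhdsWithin_le_nhds
  simp only [solvesODE_iff, Complex.ofReal_zero, sub_zero]
  exact ⟨fun α hα => identity α (poch_ofReal_add_one_ne_zero hα _),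
    fun z hz => (limits z hz).imp (·.comp tendsto_ofReal)
      (.imp (·.comp tendsto_ofReal) (·.comp tendsto_ofReal)),
    limit_identity, limit_solutions⟩
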